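/- Let $\mathcal A$ be a finite alphabet with $k=\#\mathcal A$ letters and let $\mathbf u=u_0u_1u_2\cdots$ be an infinite word over $\mathcal A$ in which every letter of $\mathcal A$ occurs. Let $\mathcal L(\mathbf u)$ be the set of all finite factors of $\mathbf u$ (including the empty word), and let $\mathcal C(n)$ be the number of factors of length $n$. For a factor $w$ put $$\mathrm{Lext}(w)=\{a\in\mathcal A : aw\in\mathcal L(\mathbf u)\},\quad \mathrm{Rext}(w)=\{b\in\mathcal A : wb\in\mathcal L(\mathbf u)\},\quad \mathrm{Bext}(w)=\{awb\in\mathcal L(\mathbf u) : a,b\in\mathcal A\}.$$ The factor $w$ is bispecial if $\#\mathrm{Lext}(w)\ge 2$ and $\#\mathrm{Rext}(w)\ge 2$; a bispecial factor $w$ is ordinary if its bilateral order $\mathrm b(w)=\#\mathrm{Bext}(w)-\#\mathrm{Rext}(w)-\#\mathrm{Lext}(w)+1$ equals $0$. A palindromic extension of a palindrome $w$ is a word of the form $awa\in\mathcal L(\mathbf u)$ with $a\in\mathcal A$. **Theorem.** Assume that $\mathcal L(\mathbf u)$ is closed under reversal (it contains with every factor its mirror image) and that $\mathcal C(n)=(k-1)n+1$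 for all $n\in\mathbb N=\{0,1,2,\dots\}$. Then the following are equivalent: - ($\mathcal{PE}$) every palindrome in $\mathcal L(\mathbf u)$, including the empty word, has exactly one palindromic extension; - ($\mathcal{BO}$) all bispecial factors of $\mathbf u$ are ordinary. -/

import Mathlib

namespace InfWord

variable {A : Type*}

/-- The language of the infinite word `u = u 0, u 1, u 2, …`: the finite words `w` that occur
in `u` at some index `i`, that is `w = u i, u (i+1), …, u (i + |w| - 1)`. -/
def language (u : ℕ → A) : Set (List A) :=
  {w | ∃ i : ℕ, w = (List.range w.length).map (fun j => u (i + j))}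

/-- The language of `u` contains with every factor also its reversal. -/
def ClosedUnderReversal (u : ℕ → A) : Prop :=
  ∀ w ∈ language u, w.reverse ∈ language u

/-- The factor complexity: the number of factors of length `n`. -/
noncomputable def complexity (u : ℕ → A) (n : ℕ) : ℕ :=
  {w ∈ language u | w.length = n}.ncard

/-- The left extensions of `w`: the letters `a` such that `aw` is a factor. -/
def leftExt (u : ℕ → A) (w : List A) : Set A :=
  {a | a :: w ∈ language u}

/-- The right extensions of `w`: the letters `b` such that `wb` is a factor. -/
def rightExt (u : ℕ → A) (w : List A) : Set A :=
  {b | w ++ [b] ∈ language u}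

/-- The factors of the form `awb` with letters `a`, `b`. -/
def biExt (u : ℕ → A) (w : List A) : Set (List A) :=
  {v ∈ language u | ∃ a b : A, v = a :: (w ++ [b])}

/-- The palindromic extensions of `w`: the factors of the form `awa` with a letter `a`. -/
def palExt (u : ℕ → A) (w : List A) : Set (List A) :=
  {v ∈ language u | ∃ a : A, v = a :: (w ++ [a])}

/-- A word is a palindrome if it coincides with its mirror image. -/
def IsPalindrome (w : List A) : Prop := w.reverse = w

/-- A bispecial factor has at least two left and at least two right extensions. -/
def IsBispecial (u : ℕ → A) (w : List A) : Prop :=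
  w ∈ language u ∧ 2 ≤ (leftExt u w).ncard ∧ 2 ≤ (rightExt u w).ncard

/-- The bilateral order `b(w) = #Bext(w) - #Rext(w) - #Lext(w) + 1`. -/
noncomputable def bilateralOrder (u : ℕ → A) (w : List A) : ℤ :=
  ((biExt u w).ncard : ℤ) - ((rightExt u w).ncard : ℤ) - ((leftExt u w).ncard : ℤ) + 1

/-- The complexity of `u` is `(k - 1) n + 1` for all `n`, where `k` is the size of the
alphabet. -/
def PropertyC [Fintype A] (u : ℕ → A) : Prop :=
  ∀ n : ℕ, (complexity u n : ℤ) = ((Fintype.card A : ℤ) - 1) * (n : ℤ) + 1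

/-- All bispecial factors of `u` are ordinary, i.e. of bilateral order zero. -/
def PropertyBO (u : ℕ → A) : Prop :=
  ∀ w : List A, IsBispecial u w → bilateralOrder u w = 0

/-- Every palindromic factor of `u` (the empty word included) has exactly one palindromic
extension in `u`. -/
def PropertyPE (u : ℕ → A) : Prop :=
  ∀ w ∈ language u, IsPalindrome w → ∃! v : List A, v ∈ palExt u w

end InfWord

/-! Write `C n` and `P n` for the numbers of factors and palindromic factors of length `n`. Form the
graph whose vertices are the classes {w, reversal of w} of factors of length `n`, and whose edges
are the classes of non-palindromic factors of length `n + 1`, joining prefix to suffix. It has `(C n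
+ P n) / 2` vertices and `(C (n+1) - P (n+1)) / 2` edges. Closure under reversal makes `u`
recurrent, so `u` walks through the whole graph, which is therefore connected. Hence `P n + P (n+1)
≤ C (n+1) - C n + 2`, with equality exactly for a tree. Under the complexity hypothesis the bound is
the constant `k + 1`, attained at `n = 0`.

PE ⇒ BO: unique palindromic extensions give `P (n+2) = P n`, so every graph is a tree. The
extensions of a factor span a forest in it, which forces `b(w) ≤ 0` (`card_biWords_add_one_le`). The
sum of `b(w)` over factors of one length is a second difference of `C`, hence zero, and every term
vanishes.

BO ⇒ PE: by parity every palindrome has a palindromic extension (`card_palWords_pos`), so `P (n+2) ≥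
P n`. The upper bound `k + 1` forces equality, leaving exactly one extension each. -/

namespace InfWord

open Finset

/-! ### Counting edges along a walk -/

section Walk

/-- A walk starting in `S` first reaches each vertex outside `S` through a new edge. -/
theorem card_le_card_add_card_of_walk {V E : Type*} [DecidableEq V] (x : ℕ → V) (e : ℕ → E)
    (he : ∀ i j, e i = e j →
      x (i + 1) = x (j + 1) ∨ (x i = x (j + 1) ∧ x (i + 1) = x j))
    (S T : Finset V) (F : Finset E) (h0 : x 0 ∈ S) (hT : ∀ v ∈ T, ∃ i, x i = v)
    (hF : ∀ i, x i ≠ x (i + 1) → x (i + 1) ∉ S → e i ∈ F) : #T ≤ #F + #S := by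
  classical
  have key : #(T \ S) ≤ #F := by
    have first : ∀ v ∈ T \ S, ∃ i, x (i + 1) = v ∧ ∀ j ≤ i, x j ≠ v := by
      intro v hv
      rw [mem_sdiff] at hv
      have hex := hT v hv.1
      have hspec := Nat.find_spec hex
      have hmin : ∀ j < Nat.find hex, x j ≠ v := fun j hj => Nat.find_min hex hj
      rcases hn : Nat.find hex with _ | i
      · rw [hn] at hspec
        exact absurd (hspec ▸ h0) hv.2
      · rw [hn] at hspec hmin
        exact ⟨i, hspec, fun j hj => hmin j (by omega)⟩
    choose! f hf hlt using first
    refine card_le_card_of_injOn (fun v => e (f v)) ?_ ?_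
    · intro v hv
      refine hF _ ?_ ?_
      · rw [hf v hv]
        exact hlt v hv _ le_rfl
      · rw [hf v hv]
        exact (mem_sdiff.1 hv).2
    · intro v hv v' hv' h
      rcases he _ _ h with h1 | ⟨h1, h2⟩
      · rwa [hf v hv, hf v' hv'] at h1
      -- The edge is crossed in opposite directions, so each of `v`, `v'` would be visited before
      -- the first arrival at the other.
      · rw [hf v' hv'] at h1
        rw [hf v hv] at h2
        have a1 : ¬ f v ≤ f v' := fun hle => hlt v' hv' _ hle h1
        have a2 : ¬ f v' ≤ f v := fun hle => hlt v hv _ hle h2.symm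
        omega
  have := card_le_card_sdiff_add_card (s := T) (t := S)
  omega

end Walk

/-! ### Words up to reversal -/

section ReversalClass

variable {A : Type*}

theorem IsPalindrome.reverse_eq {w : List A} (h : IsPalindrome w) : w.reverse = w := h

theorem IsPalindrome.dropLast_tail {v : List A} (h : IsPalindrome v) :
    IsPalindrome v.tail.dropLast := by
  have h2 : v.dropLast.tail = v.tail.dropLast := by
    rcases v with _ | ⟨a, _ | ⟨b, v⟩⟩ <;> simp
  rw [IsPalindrome, ← List.tail_reverse, ← List.dropLast_reverse, h.reverse_eq, h2]

/-- The unordered pair consisting of a word and its mirror image. -/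
def reversalClass (w : List A) : Sym2 (List A) := s(w, w.reverse)

theorem reversalClass_eq_iff {v w : List A} :
    reversalClass v = reversalClass w ↔ v = w ∨ v = w.reverse := by
  simp only [reversalClass, Sym2.eq_iff]
  constructor
  · rintro (h | h)
    · exact Or.inl h.1
    · exact Or.inr h.1
  · rintro (h | h) <;> simp [h]

theorem reversalClass_reverse (w : List A) : reversalClass w.reverse = reversalClass w :=
  reversalClass_eq_iff.2 (Or.inr rfl)

open Classical in
-- A class has one element if it consists of a palindrome and two otherwise; giving palindromes
-- weight 2 makes every class weigh 2.
theorem two_mul_card_image_reversalClass (X : Finset (List A)) (hX : ∀ w ∈ X, w.reverse ∈ X) :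
    2 * #(X.image reversalClass) = #X + #{w ∈ X | IsPalindrome w} := by
  have h1 : #X + #{w ∈ X | IsPalindrome w} = ∑ w ∈ X, (1 + if IsPalindrome w then 1 else 0) := by
    rw [sum_add_distrib, card_eq_sum_ones, card_filter]
  rw [h1, ← sum_fiberwise_of_maps_to (fun w hw => mem_image_of_mem reversalClass hw),
    sum_const_nat (m := 2), mul_comm]
  intro c hc
  obtain ⟨w, hw, rfl⟩ := mem_image.1 hc
  have hfib : {v ∈ X | reversalClass v = reversalClass w} = {w, w.reverse} := by
    ext v
    simp only [mem_filter, reversalClass_eq_iff, mem_insert, mem_singleton]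
    constructor
    · exact fun h => h.2
    · rintro (h | h)
      · exact ⟨h ▸ hw, Or.inl h⟩
      · exact ⟨h ▸ hX w hw, Or.inr h⟩
  rw [hfib]
  by_cases hp : IsPalindrome w
  · rw [hp.reverse_eq]
    simp [hp]
  · have hne : w ≠ w.reverse := fun h => hp h.symm
    have hp' : ¬ IsPalindrome w.reverse := fun h => hne (by simpa [IsPalindrome] using h)
    rw [sum_pair hne]
    simp [hp, hp']

open Classical in
theorem two_mul_card_image_reversalClass_nonpalindromes (X : Finset (List A))
    (hX : ∀ w ∈ X, w.reverse ∈ X) :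
    2 * #({w ∈ X | ¬ IsPalindrome w}.image reversalClass) + #{w ∈ X | IsPalindrome w} = #X := by
  rw [two_mul_card_image_reversalClass]
  · have h0 : #{w ∈ {w ∈ X | ¬ IsPalindrome w} | IsPalindrome w} = 0 := by
      rw [card_eq_zero, filter_filter]
      exact filter_false_of_mem fun w _ h => h.1 h.2
    have := card_filter_add_card_filter_not (s := X) fun w => IsPalindrome w
    omega
  · intro w hw
    rw [mem_filter] at hw ⊢
    exact ⟨hX w hw.1, fun h => hw.2 (by simpa [IsPalindrome, eq_comm] using h)⟩

end ReversalClass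

/-! ### Occurrences of factors and recurrence -/

section Window

variable {A : Type*} (u : ℕ → A)

/-- The factor of `u` of length `n` at index `i`. -/
def window (i n : ℕ) : List A := (List.range n).map fun j => u (i + j)

@[simp]
theorem length_window (i n : ℕ) : (window u i n).length = n := by simp [window]

theorem window_succ (i n : ℕ) : window u i (n + 1) = window u i n ++ [u (i + n)] := by
  simp [window, List.range_succ]

theorem window_succ' (i n : ℕ) : window u i (n + 1) = u i :: window u (i + 1) n := by
  simp [window, List.range_succ_eq_map, Function.comp_def, add_assoc, add_comm 1]

theorem tail_window (i n : ℕ) : (window u i (n + 1)).tail = window u (i + 1) n := by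
  rw [window_succ', List.tail_cons]

theorem dropLast_window (i n : ℕ) : (window u i (n + 1)).dropLast = window u i n := by
  rw [window_succ, List.dropLast_concat]

variable {u}

theorem mem_language_iff {w : List A} : w ∈ language u ↔ ∃ i, window u i w.length = w :=
  exists_congr fun _ => eq_comm

theorem window_mem_language (i n : ℕ) : window u i n ∈ language u :=
  mem_language_iff.2 ⟨i, by rw [length_window]⟩

theorem tail_mem_language {w : List A} (h : w ∈ language u) : w.tail ∈ language u := by
  obtain ⟨i, hi⟩ := mem_language_iff.1 h
  rcases w with _ | ⟨a, w⟩
  · exact h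
  · rw [← hi, List.length_cons, tail_window]
    exact window_mem_language _ _

theorem dropLast_mem_language {w : List A} (h : w ∈ language u) : w.dropLast ∈ language u := by
  obtain ⟨i, hi⟩ := mem_language_iff.1 h
  rcases w with _ | ⟨a, w⟩
  · exact h
  · rw [← hi, List.length_cons, dropLast_window]
    exact window_mem_language _ _

theorem exists_append_mem_language {w : List A} (h : w ∈ language u) :
    ∃ b, w ++ [b] ∈ language u := by
  obtain ⟨i, hi⟩ := mem_language_iff.1 h
  refine ⟨u (i + w.length), ?_⟩
  nth_rewrite 1 [← hi]
  rw [← window_succ]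
  exact window_mem_language _ _

theorem ClosedUnderReversal.exists_cons_mem_language (hrev : ClosedUnderReversal u) {w : List A}
    (h : w ∈ language u) : ∃ a, a :: w ∈ language u := by
  obtain ⟨b, hb⟩ := exists_append_mem_language (hrev _ h)
  exact ⟨b, by simpa using hrev _ hb⟩

/-- Every factor occurs arbitrarily late. -/
theorem ClosedUnderReversal.exists_window_eq (hrev : ClosedUnderReversal u) (t : ℕ) {w : List A}
    (h : w ∈ language u) : ∃ i, window u (t + i) w.length = w := by
  induction t generalizing w with
  | zero => simpa using mem_language_iff.1 h
  | succ t ih =>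
    -- An occurrence of `a :: w` at an index at least `t` places `w` one index later.
    obtain ⟨a, ha⟩ := hrev.exists_cons_mem_language h
    obtain ⟨i, hi⟩ := ih ha
    refine ⟨i, ?_⟩
    rw [List.length_cons, window_succ', List.cons.injEq] at hi
    rw [← hi.2, length_window, add_right_comm]

end Window

/-! ### Counting factors and their extensions -/

noncomputable section Factors

open Classical

variable {A : Type*} [Fintype A] (u : ℕ → A)

theorem finite_factors (n : ℕ) : {w ∈ language u | w.length = n}.Finite :=
  (List.finite_length_eq A n).subset fun _ h => h.2

/-- The factors of length `n`. -/
def factors (n : ℕ) : Finset (List A) := (finite_factors u n).toFinset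

/-- The palindromic factors of length `n`. -/
def palindromes (n : ℕ) : Finset (List A) := {w ∈ factors u n | IsPalindrome w}

/-- The factors of the form `aw`. -/
def leftWords (w : List A) : Finset (List A) := {v ∈ factors u (w.length + 1) | v.tail = w}

/-- The factors of the form `wb`. -/
def rightWords (w : List A) : Finset (List A) := {v ∈ factors u (w.length + 1) | v.dropLast = w}

/-- The factors of the form `awb`. -/
def biWords (w : List A) : Finset (List A) :=
  {v ∈ factors u (w.length + 2) | v.tail.dropLast = w}

/-- The palindromic factors of the form `awb`. -/
def palWords (w : List A) : Finset (List A) := {v ∈ biWords u w | IsPalindrome v}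

variable {u}

theorem mem_factors {n : ℕ} {w : List A} : w ∈ factors u n ↔ w ∈ language u ∧ w.length = n := by
  simp [factors]

theorem card_factors (n : ℕ) : #(factors u n) = complexity u n :=
  (Set.ncard_eq_toFinset_card _ (finite_factors u n)).symm

theorem window_mem_factors (i n : ℕ) : window u i n ∈ factors u n :=
  mem_factors.2 ⟨window_mem_language _ _, length_window _ _ _⟩

theorem reverse_mem_factors (hrev : ClosedUnderReversal u) {n : ℕ} {w : List A}
    (h : w ∈ factors u n) : w.reverse ∈ factors u n := by
  rw [mem_factors] at h ⊢
  exact ⟨hrev _ h.1, by simp [h.2]⟩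

theorem mem_leftWords {w v : List A} :
    v ∈ leftWords u w ↔ v ∈ language u ∧ ∃ a, v = a :: w := by
  rcases v with _ | ⟨a, v⟩
  · simp [leftWords, mem_factors]
  · simp only [leftWords, mem_filter, mem_factors, List.length_cons, List.tail_cons,
      List.cons.injEq]
    grind

theorem mem_rightWords {w v : List A} :
    v ∈ rightWords u w ↔ v ∈ language u ∧ ∃ b, v = w ++ [b] := by
  rcases List.eq_nil_or_concat v with rfl | ⟨v, a, rfl⟩
  · simp [rightWords, mem_factors]
  · simp only [rightWords, mem_filter, mem_factors, List.concat_eq_append, List.length_append,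
      List.dropLast_concat]
    constructor
    · rintro ⟨⟨hv, -⟩, rfl⟩
      exact ⟨hv, a, rfl⟩
    · rintro ⟨hv, b, h⟩
      obtain ⟨rfl, -⟩ := List.append_inj' h rfl
      exact ⟨⟨hv, rfl⟩, rfl⟩

theorem mem_biWords {w v : List A} :
    v ∈ biWords u w ↔ v ∈ language u ∧ ∃ a b, v = a :: (w ++ [b]) := by
  rcases v with _ | ⟨a, v⟩
  · simp [biWords, mem_factors]
  rcases List.eq_nil_or_concat v with rfl | ⟨v, b, rfl⟩
  · simp [biWords, mem_factors]
  · simp only [biWords, mem_filter, mem_factors, List.concat_eq_append, List.length_append,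
      List.dropLast_concat, List.tail_cons, List.length_cons]
    constructor
    · rintro ⟨⟨hv, -⟩, rfl⟩
      exact ⟨hv, a, b, rfl⟩
    · rintro ⟨hv, a', b', h⟩
      obtain ⟨rfl, -⟩ := List.append_inj' (List.cons.inj h).2 rfl
      exact ⟨⟨hv, rfl⟩, rfl⟩

theorem ncard_leftExt (w : List A) : (leftExt u w).ncard = #(leftWords u w) := by
  rw [← Set.ncard_image_of_injective (leftExt u w) (f := fun a => a :: w)
    (fun a b h => (List.cons.inj h).1), ← Set.ncard_coe_finset]
  congr 1
  ext v
  simp only [leftExt, Set.mem_image, Set.mem_ofPred_eq, mem_coe, mem_leftWords]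
  grind

theorem ncard_rightExt (w : List A) : (rightExt u w).ncard = #(rightWords u w) := by
  rw [← Set.ncard_image_of_injective (rightExt u w) (f := fun a => w ++ [a])
    (fun a b h => by simpa using h), ← Set.ncard_coe_finset]
  congr 1
  ext v
  simp only [rightExt, Set.mem_image, Set.mem_ofPred_eq, mem_coe, mem_rightWords]
  grind

theorem ncard_biExt (w : List A) : (biExt u w).ncard = #(biWords u w) := by
  rw [← Set.ncard_coe_finset]
  congr 1
  ext v
  simp only [biExt, Set.mem_ofPred_eq, mem_coe, mem_biWords]

theorem mem_palWords {w : List A} (hw : IsPalindrome w) {v : List A} :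
    v ∈ palWords u w ↔ v ∈ palExt u w := by
  rw [palWords, mem_filter, mem_biWords]
  constructor
  · rintro ⟨⟨hv, a, b, rfl⟩, hp⟩
    simp only [IsPalindrome, List.reverse_cons, List.reverse_append, List.reverse_nil,
      List.nil_append, List.cons_append, List.cons.injEq] at hp
    exact ⟨hv, a, by rw [hp.1]⟩
  · rintro ⟨hv, a, rfl⟩
    exact ⟨⟨hv, a, a, rfl⟩, by simp [IsPalindrome, hw.reverse_eq]⟩

theorem existsUnique_palExt_iff {w : List A} (hw : IsPalindrome w) :
    (∃! v, v ∈ palExt u w) ↔ #(palWords u w) = 1 := by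
  simp only [card_eq_one, singleton_iff_unique_mem, mem_palWords hw]

theorem bilateralOrder_eq_zero_iff (w : List A) :
    bilateralOrder u w = 0 ↔ #(biWords u w) + 1 = #(leftWords u w) + #(rightWords u w) := by
  rw [bilateralOrder, ncard_biExt, ncard_leftExt, ncard_rightExt]
  omega

theorem sum_card_leftWords (n : ℕ) :
    ∑ w ∈ factors u n, #(leftWords u w) = #(factors u (n + 1)) := by
  rw [card_eq_sum_card_fiberwise (f := List.tail) (t := factors u n)]
  · refine sum_congr rfl fun w hw => ?_
    rw [leftWords, (mem_factors.1 hw).2]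
  · intro v hv
    rw [mem_coe, mem_factors] at hv ⊢
    exact ⟨tail_mem_language hv.1, by simp [hv.2]⟩

theorem sum_card_rightWords (n : ℕ) :
    ∑ w ∈ factors u n, #(rightWords u w) = #(factors u (n + 1)) := by
  rw [card_eq_sum_card_fiberwise (f := List.dropLast) (t := factors u n)]
  · refine sum_congr rfl fun w hw => ?_
    rw [rightWords, (mem_factors.1 hw).2]
  · intro v hv
    rw [mem_coe, mem_factors] at hv ⊢
    exact ⟨dropLast_mem_language hv.1, by simp [hv.2]⟩

theorem sum_card_biWords (n : ℕ) :
    ∑ w ∈ factors u n, #(biWords u w) = #(factors u (n + 2)) := by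
  rw [card_eq_sum_card_fiberwise (f := fun v => v.tail.dropLast) (t := factors u n)]
  · refine sum_congr rfl fun w hw => ?_
    rw [biWords, (mem_factors.1 hw).2]
  · intro v hv
    rw [mem_coe, mem_factors] at hv ⊢
    exact ⟨dropLast_mem_language (tail_mem_language hv.1), by simp [hv.2]⟩

theorem sum_card_palWords (n : ℕ) :
    ∑ w ∈ palindromes u n, #(palWords u w) = #(palindromes u (n + 2)) := by
  rw [card_eq_sum_card_fiberwise (s := palindromes u (n + 2)) (f := fun v => v.tail.dropLast)
    (t := palindromes u n)]
  · refine sum_congr rfl fun w hw => ?_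
    rw [palWords, biWords, palindromes, (mem_factors.1 (mem_filter.1 hw).1).2, filter_filter,
      filter_filter]
    simp only [and_comm]
  · intro v hv
    rw [mem_coe, palindromes, mem_filter, mem_factors] at hv ⊢
    exact ⟨⟨dropLast_mem_language (tail_mem_language hv.1.1), by simp [hv.1.2]⟩,
      hv.2.dropLast_tail⟩

/-! ### The graph of reversal classes -/

variable (u) in
/-- The classes of the non-palindromic factors of length `n`. -/
def edgeClasses (n : ℕ) : Finset (Sym2 (List A)) :=
  {w ∈ factors u n | ¬ IsPalindrome w}.image reversalClass

theorem two_mul_card_edgeClasses (hrev : ClosedUnderReversal u) (n : ℕ) :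
    2 * #(edgeClasses u n) + #(palindromes u n) = #(factors u n) :=
  two_mul_card_image_reversalClass_nonpalindromes _ fun _ => reverse_mem_factors hrev

theorem two_mul_card_vertices (hrev : ClosedUnderReversal u) (n : ℕ) :
    2 * #((factors u n).image reversalClass) = #(factors u n) + #(palindromes u n) :=
  two_mul_card_image_reversalClass _ fun _ => reverse_mem_factors hrev

/-- In the connected graph whose vertices are the classes of factors of length `n` and whose
edges are the classes of non-palindromic factors of length `n + 1`, contract the vertex set `S`
together with the edges `G` inside `S`. -/
theorem card_vertices_add_card_le (hrev : ClosedUnderReversal u) (n : ℕ)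
    (S G : Finset (Sym2 (List A))) (hS : ∃ w ∈ factors u n, reversalClass w ∈ S)
    (hG : G ⊆ edgeClasses u (n + 1))
    (hGS : ∀ v ∈ factors u (n + 1), reversalClass v ∈ G → reversalClass v.tail ∈ S) :
    #((factors u n).image reversalClass) + #G ≤ #(edgeClasses u (n + 1)) + #S := by
  obtain ⟨w, hw, hwS⟩ := hS
  obtain ⟨t, ht⟩ := mem_language_iff.1 (mem_factors.1 hw).1
  rw [(mem_factors.1 hw).2] at ht
  have key := card_le_card_add_card_of_walk (fun i => reversalClass (window u (t + i) n))
    (fun i => reversalClass (window u (t + i) (n + 1))) ?_ S ((factors u n).image reversalClass)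
    (edgeClasses u (n + 1) \ G) ?_ ?_ ?_
  · have := card_sdiff_add_card_eq_card hG
    omega
  -- Equal words have equal ends; a word and its reversal have their ends interchanged.
  · intro i j h
    have hd : ∀ i, window u (t + i) n = (window u (t + i) (n + 1)).dropLast := fun i =>
      (dropLast_window u _ _).symm
    have ht : ∀ i, window u (t + (i + 1)) n = (window u (t + i) (n + 1)).tail := fun i =>
      (tail_window u _ _).symm
    rw [ht, ht, hd, hd]
    rcases reversalClass_eq_iff.1 h with h | h
    · left
      rw [h]
    · right
      rw [h, List.tail_reverse, List.dropLast_reverse, reversalClass_reverse,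
        reversalClass_reverse]
      exact ⟨rfl, rfl⟩
  · simpa [ht] using hwS
  · intro c hc
    obtain ⟨v, hv, rfl⟩ := mem_image.1 hc
    obtain ⟨i, hi⟩ := hrev.exists_window_eq t (mem_factors.1 hv).1
    rw [(mem_factors.1 hv).2] at hi
    exact ⟨i, by simp only [hi]⟩
  -- A palindromic step is a loop, since its prefix is the reversal of its suffix; a step in `G`
  -- ends in `S`. So a step to a different vertex outside `S` is neither.
  · intro i hne hnS
    rw [mem_sdiff]
    refine ⟨mem_image_of_mem _ (mem_filter.2 ⟨window_mem_factors _ _, fun hp => hne ?_⟩),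
      fun hmem => hnS ?_⟩
    · rw [← add_assoc, ← tail_window, ← dropLast_window u (t + i) n]
      nth_rewrite 1 [← hp.reverse_eq]
      rw [List.dropLast_reverse, reversalClass_reverse]
    · have := hGS _ (window_mem_factors _ _) hmem
      rwa [tail_window] at this

/-- Connectedness: contracting a single vertex gives at most one more vertex than edges. -/
theorem card_palindromes_add_le (hrev : ClosedUnderReversal u) (n : ℕ) :
    #(palindromes u n) + #(palindromes u (n + 1)) + #(factors u n) ≤ #(factors u (n + 1)) + 2 := by
  have h := card_vertices_add_card_le hrev n {reversalClass (window u 0 n)} ∅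
    ⟨_, window_mem_factors 0 n, mem_singleton_self _⟩ (empty_subset _) (by simp)
  rw [card_empty, card_singleton] at h
  have h1 := two_mul_card_vertices hrev n
  have h2 := two_mul_card_edgeClasses hrev (n + 1)
  omega

/-! ### Extensions of a factor as a subgraph -/

theorem card_leftWords_pos (hrev : ClosedUnderReversal u) {w : List A} (h : w ∈ language u) :
    0 < #(leftWords u w) := by
  obtain ⟨a, ha⟩ := hrev.exists_cons_mem_language h
  exact card_pos.2 ⟨_, mem_leftWords.2 ⟨ha, a, rfl⟩⟩

theorem card_biWords_pos (hrev : ClosedUnderReversal u) {w : List A} (h : w ∈ language u) :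
    0 < #(biWords u w) := by
  obtain ⟨a, ha⟩ := hrev.exists_cons_mem_language h
  obtain ⟨b, hb⟩ := exists_append_mem_language ha
  exact card_pos.2 ⟨_, mem_biWords.2 ⟨hb, a, b, rfl⟩⟩

theorem tail_mem_rightWords {w v : List A} (h : v ∈ biWords u w) : v.tail ∈ rightWords u w := by
  obtain ⟨hv, a, b, rfl⟩ := mem_biWords.1 h
  exact mem_rightWords.2 ⟨tail_mem_language hv, b, rfl⟩

theorem dropLast_mem_leftWords {w v : List A} (h : v ∈ biWords u w) :
    v.dropLast ∈ leftWords u w := by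
  obtain ⟨hv, a, b, rfl⟩ := mem_biWords.1 h
  exact mem_leftWords.2 ⟨dropLast_mem_language hv, a, by
    rw [← List.cons_append, List.dropLast_concat]⟩

theorem reverse_mem_biWords (hrev : ClosedUnderReversal u) {w v : List A} (hw : IsPalindrome w)
    (h : v ∈ biWords u w) : v.reverse ∈ biWords u w := by
  obtain ⟨hv, a, b, rfl⟩ := mem_biWords.1 h
  exact mem_biWords.2 ⟨hrev _ hv, b, a, by simp [hw.reverse_eq]⟩

theorem image_reverse_leftWords (hrev : ClosedUnderReversal u) {w : List A} (hw : IsPalindrome w) :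
    (leftWords u w).image List.reverse = rightWords u w := by
  ext v
  simp only [mem_image, mem_leftWords, mem_rightWords]
  constructor
  · rintro ⟨_, ⟨hv, a, rfl⟩, rfl⟩
    exact ⟨hrev _ hv, a, by simp [hw.reverse_eq]⟩
  · rintro ⟨hv, b, rfl⟩
    exact ⟨_, ⟨hrev _ hv, b, by simp [hw.reverse_eq]⟩, List.reverse_reverse _⟩

theorem card_rightWords_eq (hrev : ClosedUnderReversal u) {w : List A} (hw : IsPalindrome w) :
    #(rightWords u w) = #(leftWords u w) := by
  rw [← image_reverse_leftWords hrev hw, card_image_of_injective _ List.reverse_injective]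

theorem image_reversalClass_rightWords (hrev : ClosedUnderReversal u) {w : List A}
    (hw : IsPalindrome w) :
    (rightWords u w).image reversalClass = (leftWords u w).image reversalClass := by
  rw [← image_reverse_leftWords hrev hw, image_image]
  exact image_congr fun v _ => reversalClass_reverse v

/-- If the graph of `card_vertices_add_card_le` is a tree, the extensions of a factor span a
forest in it. -/
theorem card_edges_lt_card_vertices (hrev : ClosedUnderReversal u) {w : List A}
    (hw : w ∈ language u)
    (htree : #(palindromes u (w.length + 1)) + #(palindromes u (w.length + 2)) +
      #(factors u (w.length + 1)) = #(factors u (w.length + 2)) + 2) :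
    #({v ∈ biWords u w | ¬ IsPalindrome v}.image reversalClass) + 1 ≤
      #((leftWords u w).image reversalClass ∪ (rightWords u w).image reversalClass) := by
  have h := card_vertices_add_card_le hrev (w.length + 1)
    ((leftWords u w).image reversalClass ∪ (rightWords u w).image reversalClass)
    ({v ∈ biWords u w | ¬ IsPalindrome v}.image reversalClass) ?_ ?_ ?_
  · have h1 := two_mul_card_vertices hrev (w.length + 1)
    have h2 := two_mul_card_edgeClasses hrev (w.length + 2)
    rw [show w.length + 1 + 1 = w.length + 2 from rfl] at h
    omega
  · obtain ⟨v, hv⟩ := card_pos.1 (card_leftWords_pos hrev hw)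
    exact ⟨v, (mem_filter.1 hv).1, mem_union_left _ (mem_image_of_mem _ hv)⟩
  · exact image_subset_image (filter_subset_filter _ (filter_subset _ _))
  · intro v _ hc
    obtain ⟨v', hv', hc⟩ := mem_image.1 hc
    have hb := (mem_filter.1 hv').1
    rcases reversalClass_eq_iff.1 hc.symm with rfl | rfl
    · exact mem_union_right _ (mem_image_of_mem _ (tail_mem_rightWords hb))
    · rw [List.tail_reverse, reversalClass_reverse]
      exact mem_union_left _ (mem_image_of_mem _ (dropLast_mem_leftWords hb))

/-- This is `b(w) ≤ 0`, read off the forest bound. For a palindrome `w`, reversal identifies left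
with right extensions and pairs all `awb` except the single palindromic one, so both sides of the
bound are halved. Otherwise the `awb` lie in distinct classes. -/
theorem card_biWords_add_one_le (hrev : ClosedUnderReversal u) {w : List A}
    (hw : w ∈ language u)
    (htree : #(palindromes u (w.length + 1)) + #(palindromes u (w.length + 2)) +
      #(factors u (w.length + 1)) = #(factors u (w.length + 2)) + 2)
    (hpal : IsPalindrome w → #(palWords u w) = 1) :
    #(biWords u w) + 1 ≤ #(leftWords u w) + #(rightWords u w) := by
  have h := card_edges_lt_card_vertices hrev hw htree
  by_cases hp : IsPalindrome w
  · have h1 : 2 * #({v ∈ biWords u w | ¬ IsPalindrome v}.image reversalClass) +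
        #(palWords u w) = #(biWords u w) :=
      two_mul_card_image_reversalClass_nonpalindromes _ fun _ => reverse_mem_biWords hrev hp
    rw [image_reversalClass_rightWords hrev hp, union_self] at h
    have h2 : #((leftWords u w).image reversalClass) ≤ _ := card_image_le
    have h3 := hpal hp
    have h4 := card_rightWords_eq hrev hp
    omega
  -- The reversal of `awb` has the reversal of `w` in its middle, which is not `w`.
  · have hrw : ∀ v ∈ biWords u w, ∀ v' ∈ biWords u w, v ≠ v'.reverse := by
      rintro v hv v' hv' h
      obtain ⟨-, a, b, rfl⟩ := mem_biWords.1 hv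
      obtain ⟨-, a', b', rfl⟩ := mem_biWords.1 hv'
      have := congrArg (fun l => l.tail.dropLast) h
      simp only [List.tail_cons, List.dropLast_concat, List.reverse_cons, List.reverse_append,
        List.reverse_nil, List.nil_append, List.cons_append] at this
      exact hp this.symm
    have hfil : {v ∈ biWords u w | ¬ IsPalindrome v} = biWords u w :=
      filter_true_of_mem fun v hv h => hrw v hv v hv h.symm
    rw [hfil, card_image_of_injOn] at h
    · have h1 : #((leftWords u w).image reversalClass) ≤ _ := card_image_le
      have h2 : #((rightWords u w).image reversalClass) ≤ _ := card_image_le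
      have h3 := card_union_le ((leftWords u w).image reversalClass)
        ((rightWords u w).image reversalClass)
      omega
    · intro v hv v' hv' h
      exact (reversalClass_eq_iff.1 h).resolve_right (hrw v hv v' hv')

/-! ### Initial values and the two implications -/

theorem card_palindromes_zero : #(palindromes u 0) = 1 := by
  rw [card_eq_one]
  refine ⟨[], ?_⟩
  ext w
  simp only [palindromes, mem_filter, mem_factors, mem_singleton, List.length_eq_zero_iff]
  constructor
  · exact fun h => h.1.2
  · rintro rfl
    exact ⟨⟨window_mem_language 0 0, rfl⟩, rfl⟩

theorem card_palindromes_one : #(palindromes u 1) = #(factors u 1) := by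
  rw [palindromes, filter_true_of_mem]
  intro w hw
  obtain ⟨a, rfl⟩ := List.length_eq_one_iff.1 (mem_factors.1 hw).2
  rfl

theorem PropertyC.exists_card_factors (hC : PropertyC u) :
    ∃ d, ∀ n, #(factors u n) = d * n + 1 := by
  have : Nonempty A := ⟨u 0⟩
  obtain ⟨d, hd⟩ := Nat.exists_eq_succ_of_ne_zero (Fintype.card_ne_zero (α := A))
  refine ⟨d, fun n => ?_⟩
  have h := hC n
  rw [hd, ← card_factors] at h
  push_cast at h
  zify
  linarith

theorem mem_language_of_mem_palindromes {n : ℕ} {w : List A} (h : w ∈ palindromes u n) :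
    w ∈ language u :=
  (mem_factors.1 (mem_filter.1 h).1).1

theorem propertyBO_of_propertyPE (hrev : ClosedUnderReversal u) (hC : PropertyC u)
    (hPE : PropertyPE u) : PropertyBO u := by
  obtain ⟨d, hd⟩ := hC.exists_card_factors
  have hone : ∀ w ∈ language u, IsPalindrome w → #(palWords u w) = 1 := fun w hw hp =>
    (existsUnique_palExt_iff hp).1 (hPE w hw hp)
  have hstep : ∀ n, #(palindromes u (n + 2)) = #(palindromes u n) := by
    intro n
    rw [← sum_card_palWords, card_eq_sum_ones]
    exact sum_congr rfl fun w hw =>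
      hone w (mem_language_of_mem_palindromes hw) (mem_filter.1 hw).2
  -- With `d = k - 1`, the initial value is `1 + (d + 1)`. This is equality in the connectedness
  -- bound, so each graph is a tree.
  have hsum : ∀ n, #(palindromes u n) + #(palindromes u (n + 1)) = d + 2 := by
    intro n
    induction n with
    | zero => rw [card_palindromes_zero, card_palindromes_one, hd]; ring
    | succ n ih => rw [hstep, add_comm, ih]
  intro w hw
  rw [bilateralOrder_eq_zero_iff]
  have hle : ∀ v ∈ factors u w.length,
      #(biWords u v) + 1 ≤ #(leftWords u v) + #(rightWords u v) := by
    intro v hv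
    obtain ⟨hv, -⟩ := mem_factors.1 hv
    refine card_biWords_add_one_le hrev hv ?_ (hone v hv)
    rw [hsum, hd, hd]
    ring
  -- The inequalities `b(v) ≤ 0` sum to an equality because `C (n+2) + C n = 2 * C (n+1)`.
  refine (sum_eq_sum_iff_of_le hle).1 ?_ w (mem_factors.2 ⟨hw.1, rfl⟩)
  rw [sum_add_distrib, sum_add_distrib, sum_card_biWords, sum_card_leftWords,
    sum_card_rightWords, ← card_eq_sum_ones, hd, hd, hd]
  ring

/-- Parity: reversal pairs off the non-palindromic `awb`, so it suffices that their total number is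
odd. For bispecial `w`, order zero makes it twice the number of left extensions, minus one. -/
theorem card_palWords_pos (hrev : ClosedUnderReversal u) (hBO : PropertyBO u) {w : List A}
    (hw : w ∈ language u) (hp : IsPalindrome w) : 0 < #(palWords u w) := by
  have h1 : 2 * #({v ∈ biWords u w | ¬ IsPalindrome v}.image reversalClass) +
      #(palWords u w) = #(biWords u w) :=
    two_mul_card_image_reversalClass_nonpalindromes _ fun _ => reverse_mem_biWords hrev hp
  have h2 := card_rightWords_eq hrev hp
  by_cases hs : 2 ≤ #(leftWords u w)
  · have h3 := (bilateralOrder_eq_zero_iff w).1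
      (hBO w ⟨hw, by rwa [ncard_leftExt], by rwa [ncard_rightExt, h2]⟩)
    omega
  -- With at most one extension on each side there is exactly one `awb`, again an odd number.
  · have h3 : #(biWords u w) ≤ 1 := by
      refine card_le_one.2 fun v hv v' hv' => ?_
      have e1 := card_le_one.1 (by omega) _ (dropLast_mem_leftWords hv) _
        (dropLast_mem_leftWords hv')
      have e2 := card_le_one.1 (by omega) _ (tail_mem_rightWords hv) _ (tail_mem_rightWords hv')
      obtain ⟨-, a, b, rfl⟩ := mem_biWords.1 hv
      obtain ⟨-, a', b', rfl⟩ := mem_biWords.1 hv'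
      rw [← List.cons_append, ← List.cons_append, List.dropLast_concat, List.dropLast_concat] at e1
      rw [List.tail_cons, List.tail_cons] at e2
      rw [e2, (List.cons.inj e1).1]
    have h4 := card_biWords_pos hrev hw
    omega

theorem propertyPE_of_propertyBO (hrev : ClosedUnderReversal u) (hC : PropertyC u)
    (hBO : PropertyBO u) : PropertyPE u := by
  obtain ⟨d, hd⟩ := hC.exists_card_factors
  have hpos : ∀ n, ∀ w ∈ palindromes u n, 1 ≤ #(palWords u w) := fun n w hw =>
    card_palWords_pos hrev hBO (mem_language_of_mem_palindromes hw) (mem_filter.1 hw).2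
  have hmono : ∀ n, #(palindromes u n) ≤ #(palindromes u (n + 2)) := by
    intro n
    rw [← sum_card_palWords, card_eq_sum_ones]
    exact sum_le_sum (hpos n)
  have hub : ∀ n, #(palindromes u n) + #(palindromes u (n + 1)) ≤ d + 2 := by
    intro n
    have h := card_palindromes_add_le hrev n
    rw [hd, hd, mul_add] at h
    omega
  have hlb : ∀ n, d + 2 ≤ #(palindromes u n) + #(palindromes u (n + 1)) := by
    intro n
    induction n with
    | zero => rw [card_palindromes_zero, card_palindromes_one, hd]; omega
    | succ n ih =>
      have h : _ ≤ #(palindromes u (n + 1 + 1)) := hmono n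
      omega
  intro w hw hp
  rw [existsUnique_palExt_iff hp]
  -- Each palindrome contributes at least 1 to the sum `P (n+2)`, and the two bounds give `P (n+2) =
  -- P n`.
  refine ((sum_eq_sum_iff_of_le (hpos w.length)).1 ?_ w
    (mem_filter.2 ⟨mem_factors.2 ⟨hw, rfl⟩, hp⟩)).symm
  rw [sum_card_palWords, ← card_eq_sum_ones]
  have h1 := hub (w.length + 1)
  have h2 := hlb w.length
  have h3 := hmono w.length
  rw [show w.length + 1 + 1 = w.length + 2 from rfl] at h1
  omega

end Factors

end InfWord

theorem mainTheorem2 {A : Type*} [Fintype A] (u : ℕ → A) (hsurj : Function.Surjective u)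
    (hrev : InfWord.ClosedUnderReversal u) (hC : InfWord.PropertyC u) :
    InfWord.PropertyPE u ↔ InfWord.PropertyBO u :=
  ⟨InfWord.propertyBO_of_propertyPE hrev hC, InfWord.propertyPE_of_propertyBO hrev hC⟩
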